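/- Let $n > k \geq 1$ be integers, and let $K_{n,k}$ be the simplicial complex whose vertices are the surjective maps $[n]\to[k]$, where a set $\{\varphi_1,\dots,\varphi_r\}$ of surjections is a face if and only if $\varphi_1^{-1}(i)\cap\cdots\cap\varphi_r^{-1}(i)\neq\emptyset$ for every $i\in[k]$. Then $K_{n,k}$ is $(n-k-1)$-connected: for every integer $-1\le i\le n-k-1$, every continuous map from the sphere $S^{i}$ to the geometric realization of $K_{n,k}$ extends to a continuous map from the ball $B^{i+1}$ (where $S^{-1}=\emptyset$, so that the case $i=-1$ says that $K_{n,k}$ is nonempty). -/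

import Mathlib

/-- The set `V_{n,k}` of surjective maps `[n] → [k]`. -/
abbrev SurjVertex (n k : ℕ) : Type :=
  {φ : Fin n → Fin k // Function.Surjective φ}

/-- The simplicial complex `K_{n,k}` on the vertex set `V_{n,k}`: a nonempty set `σ` of surjections
is a face iff, for each `i`, the preimages `φ⁻¹(i)`, `φ ∈ σ`, have a common element.
(As usual in Mathlib, the empty face is not listed.) -/
def surjComplex (n k : ℕ) : AbstractSimplicialComplex (SurjVertex n k) where
  faces := {σ | σ.Nonempty ∧ ∀ i : Fin k, (⋂ φ ∈ σ, φ.1 ⁻¹' {i}).Nonempty}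
  isRelLowerSet_faces := by
    rintro σ ⟨hne, hσ⟩
    refine ⟨hne, fun τ hτ hτne => ⟨hτne, fun i => (hσ i).mono ?_⟩⟩
    exact Set.biInter_subset_biInter_left hτ
  singleton_mem := by
    intro φ
    refine ⟨Finset.singleton_nonempty φ, fun i => ?_⟩
    obtain ⟨j, hj⟩ := φ.2 i
    exact ⟨j, by simpa using hj⟩

/-- The geometric realization of an abstract simplicial complex on a finite vertex set `V`, as a
subspace of `ℝ^V` (with its usual topology): the union, over the faces `σ`, of the simplices
spanned by the standard basis vectors `e_v`, `v ∈ σ`. -/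
def AbstractSimplicialComplex.realization {V : Type*} [Fintype V]
    (K : AbstractSimplicialComplex V) : Set (V → ℝ) :=
  {x | x ∈ stdSimplex ℝ V ∧ ∃ σ ∈ K.faces, ∀ v, v ∉ σ → x v = 0}

/-- A space `X` is `m`-connected if, for each `i` with `-1 ≤ i ≤ m`, every continuous map from
the sphere `S^i` to `X` extends to a continuous map from the ball `B^{i+1}` to `X`.
Here `d = i + 1`; the case `d = 0` (`S^{-1} = ∅`, `B^0` a point) says that `X` is nonempty. -/
def IsMConnected (m : ℤ) (X : Type*) [TopologicalSpace X] : Prop :=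
  ∀ d : ℕ, (d : ℤ) ≤ m + 1 →
    ∀ f : C(Metric.sphere (0 : EuclideanSpace ℝ (Fin d)) 1, X),
      ∃ F : C(Metric.closedBall (0 : EuclideanSpace ℝ (Fin d)) 1, X),
        ∀ x : Metric.sphere (0 : EuclideanSpace ℝ (Fin d)) 1,
          F ⟨x.1, Metric.sphere_subset_closedBall x.2⟩ = f x

/-!
By induction on `n`, the complex of sets of maps `Fin n → κ` that take every value `i ∈ S` at a
common point satisfies the extension property for spheres of dimension less than `n - |S|`. If the
point `0` is common to all members of a nonempty face, then it accounts for a single value `j`, so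
the complex is the union over `j ∈ S` of pieces `B j` in which `0` is used at most for the value
`j`. Deleting the point `0` makes `B j` equivalent to the complex for `n - 1` and `S \ {j}`, and
any two pieces meet in the faces that cover `S` without using `0`, which form a complex equivalent
to that for `n - 1` and `S`; the latter is one degree less connected.

A union of `d`-connected complexes `B j` which meet pairwise in a common `(d - 1)`-connected complex
`A` is `d`-connected. Indeed, a map from the `d`-sphere, which is the boundary of a cube, has a
simplicial approximation on a complex `L` of dimension `d`, and one extends it simplex by simplex
over the cone on `L`: the cone over a simplex `τ` is sent to `A` if the vertices of `τ` go to a face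
of `A` and `τ` is not of top dimension, and to a suitable `B j` otherwise.
-/

open Set Metric

section Extension

variable {X E : Type*} [TopologicalSpace E]

theorem exists_continuousOn_union [TopologicalSpace X] {s t : Set X} {f g : X → E}
    (hs : IsClosed s) (ht : IsClosed t) (hf : ContinuousOn f s) (hg : ContinuousOn g t)
    (hfg : EqOn f g (s ∩ t)) :
    ∃ F : X → E, ContinuousOn F (s ∪ t) ∧ EqOn F f s ∧ EqOn F g t := by
  classical
  have hFs : EqOn (s.piecewise f g) f s := piecewise_eqOn s f g
  have hFt : EqOn (s.piecewise f g) g t := fun x hx ↦ by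
    by_cases hxs : x ∈ s
    · rw [hFs hxs, hfg ⟨hxs, hx⟩]
    · exact piecewise_eq_of_notMem s f g hxs
  exact ⟨_, (hf.congr hFs).union_of_isClosed (hg.congr hFt) hs ht, hFs, hFt⟩

theorem exists_extension_of_homotopy [NormedAddCommGroup X] [NormedSpace ℝ X] {A : Set E}
    {G : X → E} (hG : ContinuousOn G (closedBall 0 1)) (hGA : MapsTo G (closedBall 0 1) A)
    {H : ℝ × X → E} (hH : ContinuousOn H (Icc 0 1 ×ˢ sphere 0 1))
    (hHA : MapsTo H (Icc 0 1 ×ˢ sphere 0 1) A) (h0 : ∀ x ∈ sphere (0 : X) 1, H (0, x) = G x) :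
    ∃ F : X → E, ContinuousOn F (closedBall 0 1) ∧ MapsTo F (closedBall 0 1) A ∧
      ∀ x ∈ sphere (0 : X) 1, F x = H (1, x) := by
  -- `G` is used on the ball of radius `1 / 2`, and the homotopy on the shell around it.
  let inner : X → X := fun x ↦ (2 : ℝ) • x
  let outer : X → ℝ × X := fun x ↦ (2 * ‖x‖ - 1, ‖x‖⁻¹ • x)
  let shell : Set X := {x | 1 / 2 ≤ ‖x‖} ∩ closedBall 0 1
  have hinner : MapsTo inner (closedBall 0 (1 / 2)) (closedBall 0 1) := fun x hx ↦ by
    rw [mem_closedBall_zero_iff] at hx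
    rw [mem_closedBall_zero_iff, norm_smul, Real.norm_ofNat]
    linarith
  have hne : ∀ x ∈ shell, ‖x‖ ≠ 0 := fun x hx ↦ (one_half_pos.trans_le hx.1).ne'
  have houter : MapsTo outer shell (Icc 0 1 ×ˢ sphere 0 1) := fun x hx ↦ by
    have h1 : 1 / 2 ≤ ‖x‖ := hx.1
    have h2 : ‖x‖ ≤ 1 := mem_closedBall_zero_iff.1 hx.2
    exact ⟨⟨by dsimp only [outer]; linarith, by dsimp only [outer]; linarith⟩,
      by simp [outer, norm_smul, hne x hx]⟩
  have houter_cont : ContinuousOn outer shell :=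
    (by fun_prop : Continuous fun x : X ↦ 2 * ‖x‖ - 1).continuousOn.prodMk
      ((continuous_norm.continuousOn.inv₀ hne).smul continuousOn_id)
  have hagree : EqOn (G ∘ inner) (H ∘ outer) (closedBall 0 (1 / 2) ∩ shell) := fun x hx ↦ by
    have hx2 : ‖x‖ = 1 / 2 := le_antisymm (mem_closedBall_zero_iff.1 hx.1) hx.2.1
    have hout : outer x = (0, inner x) := by simp [outer, inner, hx2]
    have hmem : inner x ∈ sphere (0 : X) 1 := by simpa only [hout] using (houter hx.2).2
    simp only [Function.comp_apply, hout, h0 _ hmem]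
  have hball : closedBall (0 : X) (1 / 2) ∪ shell = closedBall 0 1 := by
    ext x
    simp only [shell, mem_union, mem_inter_iff, mem_ofPred_eq, mem_closedBall_zero_iff]
    grind
  have hshell : IsClosed shell :=
    (isClosed_le continuous_const continuous_norm).inter isClosed_closedBall
  obtain ⟨F, hF, hFin, hFout⟩ := exists_continuousOn_union isClosed_closedBall hshell
    (hG.comp (continuous_const_smul _).continuousOn hinner) (hH.comp houter_cont houter) hagree
  rw [hball] at hF
  refine ⟨F, hF, ?_, fun x hx ↦ ?_⟩
  · rw [← hball, mapsTo_union]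
    exact ⟨(hGA.comp hinner).congr hFin.symm, (hHA.comp houter).congr hFout.symm⟩
  · have hx1 : ‖x‖ = 1 := mem_sphere_zero_iff_norm.1 hx
    rw [hFout ⟨by norm_num [hx1], sphere_subset_closedBall hx⟩]
    norm_num [outer, hx1]

/-- Every continuous map from the unit sphere of `ℝ^d` to `A` extends to a continuous map from the
unit ball to `A`: the single-dimension form of connectedness in which the proof is carried out.
The norm on `Fin d → ℝ` is the sup norm, so that the sphere is the boundary of a cube. -/
def SphereExtends (d : ℕ) (A : Set E) : Prop :=
  ∀ f : (Fin d → ℝ) → E, ContinuousOn f (sphere 0 1) → MapsTo f (sphere 0 1) A →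
    ∃ F : (Fin d → ℝ) → E, ContinuousOn F (closedBall 0 1) ∧ MapsTo F (closedBall 0 1) A ∧
      EqOn F f (sphere 0 1)

theorem SphereExtends.exists_extension_of_leftInvOn [TopologicalSpace X] {d : ℕ} {A : Set E}
    (hA : SphereExtends d A) {B S : Set X} {a : X → Fin d → ℝ} {b : (Fin d → ℝ) → X}
    (ha : ContinuousOn a B) (haB : MapsTo a B (closedBall 0 1)) (haS : MapsTo a S (sphere 0 1))
    (hb : ContinuousOn b (sphere 0 1)) (hbS : MapsTo b (sphere 0 1) S) (hba : LeftInvOn b a S)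
    {f : X → E} (hf : ContinuousOn f S) (hfA : MapsTo f S A) :
    ∃ F : X → E, ContinuousOn F B ∧ MapsTo F B A ∧ EqOn F f S := by
  obtain ⟨F, hF, hFA, hFf⟩ := hA (f ∘ b) (hf.comp hb hbS) (hfA.comp hbS)
  refine ⟨F ∘ a, hF.comp ha haB, hFA.comp haB, fun x hx ↦ ?_⟩
  rw [Function.comp_apply, hFf (haS hx), Function.comp_apply, hba hx]

end Extension

section Polyhedron

variable {V W : Type*}

/-- The full preimage of a complex under a map of vertices: the complex in which every vertex `w` is
replaced by the simplex on the fiber of `r` over `w`. -/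
def comapFaces [DecidableEq W] (r : V → W) (K : LowerSet (Finset W)) : LowerSet (Finset V) where
  carrier := {σ | σ.image r ∈ K}
  lower' _ _ h hσ := K.lower (Finset.image_subset_image h) hσ

theorem mem_comapFaces [DecidableEq W] {r : V → W} {K : LowerSet (Finset W)} {σ : Finset V} :
    σ ∈ comapFaces r K ↔ σ.image r ∈ K := Iff.rfl

theorem linearMap_apply_of_injective [Finite V] [Finite W] {g : V → W}
    (hg : Function.Injective g) (x : V → ℝ) (v : V) :
    FunOnFinite.linearMap ℝ ℝ g x (g v) = x v := by
  classical
  have := Fintype.ofFinite V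
  rw [FunOnFinite.linearMap_apply_apply, Finset.sum_eq_single v] <;> simp +contextual [hg.eq_iff]

variable [Fintype V] [Fintype W]

/-- The vertices at which `x` has a nonzero barycentric coordinate; for `x` in a standard simplex
they span the face whose relative interior contains `x`. -/
noncomputable def coordSupport (x : V → ℝ) : Finset V :=
  open scoped Classical in Finset.univ.filter fun v ↦ x v ≠ 0

@[simp]
theorem mem_coordSupport {x : V → ℝ} {v : V} : v ∈ coordSupport x ↔ x v ≠ 0 := by
  simp [coordSupport]

theorem coordSupport_subset_iff {x : V → ℝ} {σ : Finset V} :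
    coordSupport x ⊆ σ ↔ ∀ v ∉ σ, x v = 0 := by
  simp only [Finset.subset_iff, mem_coordSupport]
  exact forall_congr' fun v ↦ not_imp_comm

theorem coordSupport_single [DecidableEq V] (v : V) :
    coordSupport (Pi.single v (1 : ℝ)) = {v} := by
  ext w
  simp [Pi.single_apply]

theorem coordSupport_nonempty {x : V → ℝ} (hx : x ∈ stdSimplex ℝ V) :
    (coordSupport x).Nonempty := by
  obtain ⟨v, -, hv⟩ := Finset.exists_ne_zero_of_sum_ne_zero (hx.2.trans_ne one_ne_zero)
  exact ⟨v, mem_coordSupport.2 hv⟩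

/-- The geometric realization of a simplicial complex on the vertex set `V`, in `ℝ^V`. Here and
below a complex is the lower set of its faces; unlike in Mathlib's `AbstractSimplicialComplex`,
the empty face is allowed, and a vertex need not be a face. -/
def polyhedron (K : LowerSet (Finset V)) : Set (V → ℝ) :=
  {x | x ∈ stdSimplex ℝ V ∧ coordSupport x ∈ K}

theorem polyhedron_mono : Monotone (polyhedron (V := V)) := fun _ _ h _ hx ↦ ⟨hx.1, h hx.2⟩

theorem polyhedron_sup (K L : LowerSet (Finset V)) :
    polyhedron (K ⊔ L) = polyhedron K ∪ polyhedron L := by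
  ext x
  simp only [polyhedron, mem_ofPred_eq, mem_union, LowerSet.mem_sup_iff, and_or_left]

theorem isClosed_polyhedron (K : LowerSet (Finset V)) : IsClosed (polyhedron K) := by
  have hK : polyhedron K = stdSimplex ℝ V ∩ ⋃ σ ∈ K, ⋂ v ∉ σ, {x | x v = 0} := by
    ext x
    simp only [polyhedron, mem_ofPred_eq, mem_inter_iff, mem_iUnion, mem_iInter, exists_prop,
      ← coordSupport_subset_iff]
    exact and_congr_right fun _ ↦
      ⟨fun h ↦ ⟨_, h, subset_rfl⟩, fun ⟨σ, hσ, h⟩ ↦ K.lower h hσ⟩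
  rw [hK]
  exact (isClosed_stdSimplex ℝ V).inter <| (toFinite (K : Set (Finset V))).isClosed_biUnion
    fun σ _ ↦ isClosed_biInter fun v _ ↦ isClosed_eq (continuous_apply v) continuous_const

theorem convex_polyhedron_Iic (σ : Finset V) : Convex ℝ (polyhedron (LowerSet.Iic σ)) := by
  rintro x ⟨hx, hxσ⟩ y ⟨hy, hyσ⟩ s t hs ht hst
  rw [LowerSet.mem_Iic_iff, coordSupport_subset_iff] at hxσ hyσ
  refine ⟨convex_stdSimplex ℝ V hx hy hs ht hst, coordSupport_subset_iff.2 fun v hv ↦ ?_⟩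
  simp [hxσ v hv, hyσ v hv]

theorem exists_extension_of_contiguous {X : Type*} [NormedAddCommGroup X] [NormedSpace ℝ X]
    {K : LowerSet (Finset V)} {G f : X → V → ℝ} (hG : ContinuousOn G (closedBall 0 1))
    (hGK : MapsTo G (closedBall 0 1) (polyhedron K)) (hf : ContinuousOn f (sphere 0 1))
    (hfK : MapsTo f (sphere 0 1) (polyhedron K))
    (hGf : ∀ x ∈ sphere (0 : X) 1, ∃ σ ∈ K, coordSupport (G x) ⊆ σ ∧ coordSupport (f x) ⊆ σ) :
    ∃ F : X → V → ℝ, ContinuousOn F (closedBall 0 1) ∧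
      MapsTo F (closedBall 0 1) (polyhedron K) ∧ EqOn F f (sphere 0 1) := by
  let H : ℝ × X → V → ℝ := fun p ↦ (1 - p.1) • G p.2 + p.1 • f p.2
  have hH : ContinuousOn H (Icc 0 1 ×ˢ sphere 0 1) :=
    ((continuousOn_const.sub continuousOn_fst).smul <|
      hG.comp continuousOn_snd fun p hp ↦ sphere_subset_closedBall hp.2).add
    (continuousOn_fst.smul <| hf.comp continuousOn_snd fun p hp ↦ hp.2)
  have hHK : MapsTo H (Icc 0 1 ×ˢ sphere 0 1) (polyhedron K) := by
    rintro ⟨t, x⟩ ⟨ht, hx⟩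
    obtain ⟨σ, hσ, hGσ, hfσ⟩ := hGf x hx
    exact polyhedron_mono (LowerSet.Iic_le.2 hσ) <| convex_polyhedron_Iic σ
      ⟨(hGK (sphere_subset_closedBall hx)).1, hGσ⟩ ⟨(hfK hx).1, hfσ⟩
      (sub_nonneg.2 ht.2) ht.1 (sub_add_cancel 1 t)
  obtain ⟨F, hF, hFK, hF1⟩ := exists_extension_of_homotopy hG hGK hH hHK (by simp [H])
  exact ⟨F, hF, hFK, fun x hx ↦ by simp [hF1 x hx, H]⟩

theorem sphereExtends_polyhedron_of_apex [DecidableEq V] {K : LowerSet (Finset V)}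
    (hK : ∅ ∈ K) (v : V) (hv : ∀ σ ∈ K, insert v σ ∈ K) (d : ℕ) :
    SphereExtends d (polyhedron K) := by
  intro f hf hfK
  have hapex : Pi.single v 1 ∈ polyhedron K :=
    ⟨single_mem_stdSimplex ℝ v, by simpa [coordSupport_single] using hv ∅ hK⟩
  refine exists_extension_of_contiguous (G := fun _ ↦ Pi.single v 1) continuousOn_const
    (fun _ _ ↦ hapex) hf hfK fun x hx ↦ ⟨_, hv _ (hfK hx).2, ?_, Finset.subset_insert _ _⟩
  simp [coordSupport_single]

theorem coordSupport_linearMap_subset [DecidableEq W] (g : V → W) (x : V → ℝ) :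
    coordSupport (FunOnFinite.linearMap ℝ ℝ g x) ⊆ (coordSupport x).image g := by
  intro w hw
  rw [mem_coordSupport, FunOnFinite.linearMap_apply_apply] at hw
  obtain ⟨v, hv, hxv⟩ := Finset.exists_ne_zero_of_sum_ne_zero hw
  exact Finset.mem_image.2 ⟨v, mem_coordSupport.2 hxv, (Finset.mem_filter.1 hv).2⟩

theorem mapsTo_linearMap_polyhedron [DecidableEq W] {g : V → W} {L : LowerSet (Finset V)}
    {K : LowerSet (Finset W)} (hg : ∀ σ ∈ L, σ.image g ∈ K) :
    MapsTo (FunOnFinite.linearMap ℝ ℝ g) (polyhedron L) (polyhedron K) := fun x hx ↦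
  ⟨stdSimplex.image_linearMap g (mem_image_of_mem _ hx.1),
    K.lower (coordSupport_linearMap_subset g x) (hg _ hx.2)⟩

theorem SphereExtends.of_contiguous [DecidableEq V] [DecidableEq W] {K : LowerSet (Finset V)}
    {L : LowerSet (Finset W)} {r : V → W} {s : W → V} (hr : ∀ σ ∈ K, σ.image r ∈ L)
    (hs : ∀ σ ∈ L, σ.image s ∈ K) (hsr : ∀ σ ∈ K, σ ∪ (σ.image r).image s ∈ K) {d : ℕ}
    (h : SphereExtends d (polyhedron L)) : SphereExtends d (polyhedron K) := by
  intro f hf hfK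
  obtain ⟨F, hF, hFL, hFf⟩ := h (FunOnFinite.linearMap ℝ ℝ r ∘ f)
    ((FunOnFinite.continuous_linearMap ℝ ℝ r).comp_continuousOn hf)
    ((mapsTo_linearMap_polyhedron hr).comp hfK)
  refine exists_extension_of_contiguous (G := FunOnFinite.linearMap ℝ ℝ s ∘ F)
    ((FunOnFinite.continuous_linearMap ℝ ℝ s).comp_continuousOn hF)
    ((mapsTo_linearMap_polyhedron hs).comp hFL) hf hfK
    fun x hx ↦ ⟨_, hsr _ (hfK hx).2, ?_, Finset.subset_union_left⟩
  rw [Function.comp_apply, hFf hx]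
  exact (coordSupport_linearMap_subset _ _).trans <|
    (Finset.image_subset_image (coordSupport_linearMap_subset _ _)).trans
      Finset.subset_union_right

theorem SphereExtends.comapFaces [Nonempty V] [DecidableEq W] {r : V → W}
    {K : LowerSet (Finset W)} (hr : ∀ w, {w} ∈ K → w ∈ range r) {d : ℕ}
    (h : SphereExtends d (polyhedron K)) : SphereExtends d (polyhedron (comapFaces r K)) := by
  classical
  have hinv : ∀ σ ∈ K, (σ.image (Function.invFun r)).image r = σ := fun σ hσ ↦ by
    rw [Finset.image_image, Finset.image_congr fun w hw ↦ ?_, Finset.image_id]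
    exact Function.invFun_eq (hr w (K.lower (Finset.singleton_subset_iff.2 hw) hσ))
  refine h.of_contiguous (r := r) (s := Function.invFun r) (fun _ hσ ↦ hσ) (fun σ hσ ↦ ?_)
    fun σ hσ ↦ ?_
  · rwa [mem_comapFaces, hinv σ hσ]
  · rwa [mem_comapFaces, Finset.image_union, hinv _ hσ, Finset.union_idempotent]

end Polyhedron

section Carrier

theorem exists_homeomorph_simplex_unitBall {ι P : Type*} [Finite ι] [NormedAddCommGroup P]
    [NormedSpace ℝ P] (β : AffineBasis ι ℝ P) :
    ∃ h : P ≃ₜ P, (∀ y, h y ∈ closedBall 0 1 ↔ ∀ i, 0 ≤ β.coord i y) ∧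
      ∀ y, h y ∈ sphere 0 1 ↔ (∀ i, 0 ≤ β.coord i y) ∧ ∃ i, β.coord i y = 0 := by
  have := Fintype.ofFinite ι
  have : FiniteDimensional ℝ P := β.finiteDimensional
  have : Nonempty ι := β.nonempty
  have hcompact : IsCompact (convexHull ℝ (range β)) := (finite_range β).isCompact_convexHull ℝ
  obtain ⟨h, -, hball, hsphere⟩ := exists_homeomorph_image_interior_closure_frontier_eq_unitBall
    (convex_convexHull ℝ (range β)) ⟨_, β.centroid_mem_interior_convexHull⟩ hcompact.isBounded
  rw [hcompact.isClosed.closure_eq, β.convexHull_eq_nonneg_coord] at hball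
  rw [hcompact.isClosed.frontier_eq, β.interior_convexHull, β.convexHull_eq_nonneg_coord]
    at hsphere
  refine ⟨h, fun y ↦ ?_, fun y ↦ ?_⟩
  · rw [← hball, h.injective.mem_set_image, mem_ofPred_eq]
  · rw [← hsphere, h.injective.mem_set_image, mem_sdiff, mem_ofPred_eq, mem_ofPred_eq, not_forall]
    exact and_congr_right fun hy ↦ exists_congr fun i ↦
      ⟨fun hi ↦ (not_lt.1 hi).antisymm (hy i), fun hi ↦ hi.not_gt⟩

theorem affineBasis_coord_sum_smul {ι P : Type*} [Fintype ι] [AddCommGroup P] [Module ℝ P]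
    (β : AffineBasis ι ℝ P) {w : ι → ℝ} (hw : ∑ i, w i = 1) (i : ι) :
    β.coord i (∑ j, w j • β j) = w i := by
  rw [← Finset.affineCombination_eq_linear_combination _ _ _ hw,
    β.coord_apply_combination_of_mem (Finset.mem_univ i) hw]

variable {V E : Type*} [Fintype V] [TopologicalSpace E] {σ : Finset V}

theorem restrict_mem_stdSimplex {x : V → ℝ} (hx : x ∈ polyhedron (LowerSet.Iic σ)) :
    (fun i : σ ↦ x i) ∈ stdSimplex ℝ σ := by
  refine ⟨fun i ↦ hx.1.1 i, ?_⟩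
  rw [Finset.sum_coe_sort σ x, ← hx.1.2]
  exact Finset.sum_subset (Finset.subset_univ _) fun v _ hv ↦ coordSupport_subset_iff.1 hx.2 v hv

theorem linearMap_restrict_eq {x : V → ℝ} (hx : coordSupport x ⊆ σ) :
    FunOnFinite.linearMap ℝ ℝ ((↑) : σ → V) (fun i ↦ x i) = x := by
  classical
  ext v
  by_cases hv : v ∈ σ
  · exact linearMap_apply_of_injective Subtype.val_injective _ ⟨v, hv⟩
  · rw [coordSupport_subset_iff.1 hx v hv]
    exact coordSupport_subset_iff.1 (coordSupport_linearMap_subset _ _) v (by simp [hv])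

theorem mem_polyhedron_Iio_iff {x : V → ℝ} :
    x ∈ polyhedron (LowerSet.Iio σ) ↔
      x ∈ polyhedron (LowerSet.Iic σ) ∧ ∃ v ∈ σ, x v = 0 := by
  simp only [polyhedron, mem_ofPred_eq, LowerSet.mem_Iio_iff, LowerSet.mem_Iic_iff, and_assoc]
  refine and_congr_right fun _ ↦ ⟨fun h ↦ ⟨h.1, ?_⟩, fun ⟨h, v, hv, hxv⟩ ↦ ?_⟩
  · simpa using (Finset.ssubset_iff_of_subset h.1).1 h
  · exact (Finset.ssubset_iff_of_subset h).2 ⟨v, hv, by simpa using hxv⟩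

theorem SphereExtends.exists_extension_simplex {d : ℕ} (hσ : σ.card = d + 1) {A : Set E}
    (hA : SphereExtends d A) {f : (V → ℝ) → E}
    (hf : ContinuousOn f (polyhedron (LowerSet.Iio σ)))
    (hfA : MapsTo f (polyhedron (LowerSet.Iio σ)) A) :
    ∃ F : (V → ℝ) → E, ContinuousOn F (polyhedron (LowerSet.Iic σ)) ∧
      MapsTo F (polyhedron (LowerSet.Iic σ)) A ∧ EqOn F f (polyhedron (LowerSet.Iio σ)) := by
  classical
  obtain ⟨β⟩ := AffineBasis.exists_affineBasis_of_finiteDimensional (ι := σ) (k := ℝ)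
    (P := Fin d → ℝ) (by simp [hσ])
  obtain ⟨h, hball, hsphere⟩ := exists_homeomorph_simplex_unitBall β
  let push : (σ → ℝ) → V → ℝ := FunOnFinite.linearMap ℝ ℝ (↑)
  let a : (V → ℝ) → Fin d → ℝ := fun x ↦ h (∑ i : σ, x i • β i)
  let b : (Fin d → ℝ) → V → ℝ := fun y ↦ push fun i ↦ β.coord i (h.symm y)
  have hcoord : ∀ x ∈ polyhedron (LowerSet.Iic σ), ∀ i, β.coord i (∑ j : σ, x j • β j) = x i :=
    fun x hx i ↦ affineBasis_coord_sum_smul β (restrict_mem_stdSimplex hx).2 i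
  have ha : Continuous a := h.continuous.comp (by fun_prop)
  have hb : Continuous b := (FunOnFinite.continuous_linearMap ℝ ℝ _).comp <|
    continuous_pi fun i ↦ (continuous_barycentric_coord β i).comp h.symm.continuous
  refine hA.exists_extension_of_leftInvOn (a := a) (b := b) ha.continuousOn (fun x hx ↦ ?_)
    (fun x hx ↦ ?_) hb.continuousOn (fun y hy ↦ ?_) (fun x hx ↦ ?_) hf hfA
  · exact (hball _).2 fun i ↦ (hx.1.1 i).trans_eq (hcoord x hx i).symm
  · obtain ⟨hx, v, hv, hxv⟩ := mem_polyhedron_Iio_iff.1 hx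
    exact (hsphere _).2 ⟨fun i ↦ (hx.1.1 i).trans_eq (hcoord x hx i).symm, ⟨v, hv⟩,
      (hcoord x hx ⟨v, hv⟩).trans hxv⟩
  · obtain ⟨hnonneg, i, hi⟩ := (hsphere _).1 ((h.apply_symm_apply y).symm ▸ hy)
    refine mem_polyhedron_Iio_iff.2 ⟨⟨stdSimplex.image_linearMap _
      (mem_image_of_mem _ ⟨hnonneg, β.sum_coord_apply_eq_one _⟩), ?_⟩, i, i.2,
      (linearMap_apply_of_injective Subtype.val_injective _ i).trans hi⟩
    refine (coordSupport_linearMap_subset _ _).trans fun v hv ↦ ?_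
    obtain ⟨j, -, rfl⟩ := Finset.mem_image.1 hv
    exact j.2
  · have hx := (mem_polyhedron_Iio_iff.1 hx).1
    simp only [a, b, h.symm_apply_apply, hcoord x hx]
    exact linearMap_restrict_eq hx.2

theorem exists_extension_insert_simplex {M : LowerSet (Finset V)} {d : ℕ} (hσ : σ.card = d + 1)
    (hσM : σ ∉ M) (hbd : LowerSet.Iio σ ≤ M) {A : Set E} (hA : SphereExtends d A)
    {f : (V → ℝ) → E} (hf : ContinuousOn f (polyhedron M))
    (hfA : MapsTo f (polyhedron (LowerSet.Iio σ)) A) :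
    ∃ F : (V → ℝ) → E, ContinuousOn F (polyhedron (M ⊔ LowerSet.Iic σ)) ∧
      EqOn F f (polyhedron M) ∧ MapsTo F (polyhedron (LowerSet.Iic σ)) A := by
  obtain ⟨g, hg, hgA, hgf⟩ :=
    hA.exists_extension_simplex hσ (hf.mono (polyhedron_mono hbd)) hfA
  obtain ⟨F, hF, hFf, hFg⟩ := exists_continuousOn_union (isClosed_polyhedron M)
    (isClosed_polyhedron (LowerSet.Iic σ)) hf hg fun x ⟨hxM, hxσ⟩ ↦
      (hgf ⟨hxσ.1, hxσ.2.lt_of_ne (ne_of_mem_of_not_mem hxM.2 hσM)⟩).symm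
  exact ⟨F, (polyhedron_sup M _).symm ▸ hF, hFf, hgA.congr hFg.symm⟩

theorem exists_extension_of_carrier {C : Finset V → Set E} {L M : LowerSet (Finset V)}
    (hC : MonotoneOn C L) (hML : M ≤ L) (hM : ∅ ∈ M)
    (hext : ∀ σ ∈ L, σ ∉ M → ∀ d, σ.card = d + 1 → SphereExtends d (C σ))
    {f : (V → ℝ) → E} (hf : ContinuousOn f (polyhedron M))
    (hfC : ∀ x ∈ polyhedron M, f x ∈ C (coordSupport x)) :
    ∃ F : (V → ℝ) → E, ContinuousOn F (polyhedron L) ∧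
      (∀ x ∈ polyhedron L, F x ∈ C (coordSupport x)) ∧ EqOn F f (polyhedron M) := by
  have : Finite (LowerSet (Finset V)) := .of_injective _ SetLike.coe_injective
  induction M using WellFoundedGT.induction generalizing f with
  | ind M ih =>
    obtain rfl | hlt := hML.eq_or_lt
    · exact ⟨f, hf, hfC, eqOn_refl f _⟩
    obtain ⟨σ, ⟨hσL, hσM⟩, hmin⟩ := (toFinite ((L : Set (Finset V)) \ M)).exists_minimal
      (Set.nonempty_of_ssubset hlt)
    have hbd : LowerSet.Iio σ ≤ M := fun τ hτ ↦ by
      by_contra hτM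
      exact (hmin ⟨L.lower hτ.le hσL, hτM⟩ hτ.le).not_gt hτ
    obtain ⟨d, hd⟩ := Nat.exists_eq_succ_of_ne_zero
      (Finset.card_ne_zero.2 (Finset.nonempty_iff_ne_empty.2 (ne_of_mem_of_not_mem hM hσM).symm))
    obtain ⟨g, hg, hgf, hgC⟩ := exists_extension_insert_simplex hd hσM hbd (hext σ hσL hσM d hd) hf
      fun x hx ↦ hC (L.lower hx.2.le hσL) hσL hx.2.le (hfC x (polyhedron_mono hbd hx))
    have hgcarrier : ∀ x ∈ polyhedron (M ⊔ LowerSet.Iic σ), g x ∈ C (coordSupport x) := by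
      rintro x ⟨hx, hxM | hxσ⟩
      · exact (hgf ⟨hx, hxM⟩).symm ▸ hfC x ⟨hx, hxM⟩
      · obtain heq | hlt := (LowerSet.mem_Iic_iff.1 hxσ).eq_or_lt
        · exact heq.symm ▸ hgC ⟨hx, hxσ⟩
        · exact (hgf ⟨hx, hbd hlt⟩).symm ▸ hfC x ⟨hx, hbd hlt⟩
    obtain ⟨F, hF, hFC, hFg⟩ := ih (M ⊔ LowerSet.Iic σ)
      (left_lt_sup.2 fun h ↦ hσM (h (le_refl σ)))
      (sup_le hML (LowerSet.Iic_le.2 hσL)) (Or.inl hM)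
      (fun τ hτ hτM ↦ hext τ hτ fun h ↦ hτM (Or.inl h)) hg hgcarrier
    exact ⟨F, hF, hFC, (hFg.mono (polyhedron_mono le_sup_left)).trans hgf⟩

end Carrier

section Approximation

variable {ι : Type*} [Fintype ι]

/-- The piecewise linear hat function at the vertex `v` of the Freudenthal triangulation of `ℝ^ι`,
whose simplices are the chains `v₀ < v₁ < ⋯` of integer points with `vₗ ≤ v₀ + 1` for all `l`. -/
noncomputable def latticeHat (v : ι → ℤ) (y : ι → ℝ) : ℝ :=
  max 0 (1 - ‖fun i ↦ (y i - v i)⁺‖ - ‖fun i ↦ (y i - v i)⁻‖)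

theorem continuous_latticeHat (v : ι → ℤ) : Continuous (latticeHat v) := by
  unfold latticeHat
  fun_prop

theorem latticeHat_nonneg (v : ι → ℤ) (y : ι → ℝ) : 0 ≤ latticeHat v y := le_max_left _ _

theorem latticeHat_pos_iff {v : ι → ℤ} {y : ι → ℝ} : 0 < latticeHat v y ↔
    ‖fun i ↦ (y i - v i)⁺‖ + ‖fun i ↦ (y i - v i)⁻‖ < 1 := by
  rw [latticeHat, lt_max_iff, or_iff_right (lt_irrefl _), sub_sub, sub_pos]

theorem apply_le_norm_posPart (z : ι → ℝ) (i : ι) : z i ≤ ‖fun j ↦ (z j)⁺‖ :=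
  (le_posPart (z i)).trans <| (Real.le_norm_self _).trans (norm_le_pi_norm (fun j ↦ (z j)⁺) i)

theorem neg_apply_le_norm_negPart (z : ι → ℝ) (i : ι) : -z i ≤ ‖fun j ↦ (z j)⁻‖ :=
  (neg_le_negPart (z i)).trans <| (Real.le_norm_self _).trans (norm_le_pi_norm (fun j ↦ (z j)⁻) i)

section

variable {v w : ι → ℤ} {x y : ι → ℝ}

theorem abs_sub_lt_one_of_latticeHat_pos (h : 0 < latticeHat v y) (i : ι) : |y i - v i| < 1 := by
  have hlt := latticeHat_pos_iff.1 h
  have hle := apply_le_norm_posPart (fun i ↦ y i - v i) i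
  have hge := neg_apply_le_norm_negPart (fun i ↦ y i - v i) i
  rw [abs_lt]
  constructor <;> linarith [norm_nonneg fun i ↦ (y i - v i)⁺,
    norm_nonneg fun i ↦ (y i - v i)⁻]

theorem sub_sub_sub_lt_one_of_latticeHat_pos (h : 0 < latticeHat v y) (i j : ι) :
    y i - v i - (y j - v j) < 1 := by
  have hlt := latticeHat_pos_iff.1 h
  have hle := apply_le_norm_posPart (fun i ↦ y i - v i) i
  have hge := neg_apply_le_norm_negPart (fun i ↦ y i - v i) j
  linarith

theorem le_or_le_of_latticeHat_pos (hv : 0 < latticeHat v y) (hw : 0 < latticeHat w y) :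
    v ≤ w ∨ w ≤ v := by
  refine or_iff_not_imp_left.2 fun hvw j ↦ ?_
  obtain ⟨i, hi⟩ := not_forall.1 hvw
  have hlt : ((w j - v j + (v i - w i) : ℤ) : ℝ) < (2 : ℤ) := by
    push_cast
    linarith [sub_sub_sub_lt_one_of_latticeHat_pos hv j i,
      sub_sub_sub_lt_one_of_latticeHat_pos hw i j]
  have := Int.cast_lt.1 hlt
  lia

theorem le_add_one_of_latticeHat_pos (hv : 0 < latticeHat v y) (hw : 0 < latticeHat w y) (i : ι) :
    v i ≤ w i + 1 := by
  have hlt : ((v i : ℤ) : ℝ) < (w i + 2 : ℤ) := by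
    push_cast
    linarith [abs_lt.1 (abs_sub_lt_one_of_latticeHat_pos hv i),
      abs_lt.1 (abs_sub_lt_one_of_latticeHat_pos hw i)]
  have := Int.cast_lt.1 hlt
  lia

theorem dist_le_two_of_latticeHat_pos (hx : 0 < latticeHat v x) (hy : 0 < latticeHat v y) :
    dist x y ≤ 2 := by
  refine (dist_pi_le_iff zero_le_two).2 fun i ↦ ?_
  have hxi := abs_lt.1 (abs_sub_lt_one_of_latticeHat_pos hx i)
  have hyi := abs_lt.1 (abs_sub_lt_one_of_latticeHat_pos hy i)
  rw [Real.dist_eq, abs_le]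
  constructor <;> linarith

end

theorem latticeHat_floor_pos (y : ι → ℝ) : 0 < latticeHat (fun i ↦ ⌊y i⌋) y := by
  have hpos : ‖fun i ↦ (y i - ⌊y i⌋)⁺‖ < 1 := (pi_norm_lt_iff one_pos).2 fun i ↦ by
    rw [Int.self_sub_floor, posPart_of_nonneg (Int.fract_nonneg _),
      Real.norm_of_nonneg (Int.fract_nonneg _)]
    exact Int.fract_lt_one _
  have hneg : (fun i ↦ (y i - ⌊y i⌋)⁻) = 0 := funext fun i ↦
    negPart_eq_zero.2 (sub_nonneg.2 (Int.floor_le (y i)))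
  rwa [latticeHat_pos_iff, hneg, norm_zero, add_zero]

theorem finite_setOf_latticeHat_pos {s : Set (ι → ℝ)} (hs : Bornology.IsBounded s) :
    {v : ι → ℤ | ∃ x ∈ s, 0 < latticeHat v x}.Finite := by
  classical
  obtain ⟨R, hR⟩ := hs.exists_norm_le
  refine (Set.finite_Icc (fun _ : ι ↦ ⌊-R - 1⌋) fun _ ↦ ⌈R + 1⌉).subset ?_
  rintro v ⟨x, hx, hv⟩
  have hbound : ∀ i, |(v i : ℝ)| ≤ R + 1 := fun i ↦ by
    have hxi : |x i| ≤ R := (norm_le_pi_norm x i).trans (hR x hx)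
    have hvi := abs_sub_lt_one_of_latticeHat_pos hv i
    grind
  exact ⟨fun i ↦ Int.floor_le_iff.2 (by grind), fun i ↦ Int.le_ceil_iff.2 (by grind)⟩

-- The coordinate sums of the lattice points in question are distinct, as these points form a
-- chain, and lie in an interval of length `Fintype.card ι`, as these points agree at `i₀`.
theorem card_le_of_latticeHat_pos {y : ι → ℝ} {i₀ : ι} {z : ℤ} (hz : y i₀ = z)
    {τ : Finset (ι → ℤ)} (hτ : ∀ v ∈ τ, 0 < latticeHat v y) : τ.card ≤ Fintype.card ι := by
  obtain rfl | hne := τ.eq_empty_or_nonempty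
  · simp
  have hi₀ : ∀ v ∈ τ, v i₀ = z := fun v hv ↦ by
    have hlt : |z - v i₀| < 1 := by
      exact_mod_cast hz ▸ abs_sub_lt_one_of_latticeHat_pos (hτ v hv) i₀
    exact (sub_eq_zero.1 (Int.abs_lt_one_iff.1 hlt)).symm
  obtain ⟨u, hu, hmin⟩ := Finset.exists_min_image τ (fun v ↦ ∑ i, v i) hne
  have hmaps : MapsTo (fun v : ι → ℤ ↦ ∑ i, v i) τ
      (Finset.Ico (∑ i, u i) (∑ i, u i + Fintype.card ι)) := fun v hv ↦ by
    refine Finset.mem_coe.2 (Finset.mem_Ico.2 ⟨hmin v hv, ?_⟩)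
    calc ∑ i, v i < ∑ i, (u i + 1) :=
          Finset.sum_lt_sum (fun i _ ↦ le_add_one_of_latticeHat_pos (hτ v hv) (hτ u hu) i)
            ⟨i₀, Finset.mem_univ _, by rw [hi₀ v hv, hi₀ u hu]; exact lt_add_one z⟩
      _ = ∑ i, u i + Fintype.card ι := by simp [Finset.sum_add_distrib]
  have hinj : InjOn (fun v : ι → ℤ ↦ ∑ i, v i) τ := fun v hv w hw hvw ↦ by
    have hmono : StrictMono fun v : ι → ℤ ↦ ∑ i, v i := Fintype.sum_strictMono
    obtain hle | hle := le_or_le_of_latticeHat_pos (hτ v hv) (hτ w hw)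
    · exact hle.eq_of_not_lt fun hlt ↦ (hmono hlt).ne hvw
    · exact (hle.eq_of_not_lt fun hlt ↦ (hmono hlt).ne' hvw).symm
  simpa using Finset.card_le_card_of_injOn _ hmaps hinj

theorem exists_abs_apply_eq_norm {x : ι → ℝ} (hx : x ≠ 0) : ∃ i, |x i| = ‖x‖ := by
  obtain ⟨j, -⟩ := Function.ne_iff.1 hx
  have : Nonempty ι := ⟨j⟩
  obtain ⟨i, hi⟩ := Finite.exists_max fun i ↦ |x i|
  exact ⟨i, (norm_le_pi_norm x i).antisymm ((pi_norm_le_iff_of_nonempty x).2 hi)⟩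

theorem exists_partition_of_unity {X I : Type*} [TopologicalSpace X] [Fintype I] {s : Set X}
    {u : X → I → ℝ} (hu : ContinuousOn u s) (hnonneg : ∀ x ∈ s, 0 ≤ u x)
    (hpos : ∀ x ∈ s, ∃ i, 0 < u x i) :
    ∃ p : X → I → ℝ, ContinuousOn p s ∧ MapsTo p s (stdSimplex ℝ I) ∧
      ∀ x ∈ s, coordSupport (p x) = coordSupport (u x) := by
  have hsum : ∀ x ∈ s, 0 < ∑ i, u x i := fun x hx ↦
    let ⟨i, hi⟩ := hpos x hx
    Finset.sum_pos' (fun j _ ↦ hnonneg x hx j) ⟨i, Finset.mem_univ i, hi⟩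
  refine ⟨fun x ↦ (∑ i, u x i)⁻¹ • u x, ?_, fun x hx ↦ ⟨fun i ↦ ?_, ?_⟩, fun x hx ↦ ?_⟩
  · exact ((continuousOn_finsetSum _ fun i _ ↦ continuousOn_pi.1 hu i).inv₀
      fun x hx ↦ (hsum x hx).ne').smul hu
  · exact mul_nonneg (inv_nonneg.2 (hsum x hx).le) (hnonneg x hx i)
  · simp only [Pi.smul_apply, smul_eq_mul, ← Finset.mul_sum, inv_mul_cancel₀ (hsum x hx).ne']
  · ext i
    simp [(hsum x hx).ne']

theorem exists_partition_of_unity_latticeHat {s : Set (ι → ℝ)} (hs : Bornology.IsBounded s) :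
    ∃ (I : Finset (ι → ℤ)) (p : (ι → ℝ) → I → ℝ), ContinuousOn p s ∧
      MapsTo p s (stdSimplex ℝ I) ∧ (∀ x ∈ s, ∀ v, p x v ≠ 0 → 0 < latticeHat v.1 x) ∧
      ∀ v ∈ I, ∃ x ∈ s, 0 < latticeHat v x := by
  obtain ⟨I, hI⟩ := (finite_setOf_latticeHat_pos hs).exists_finset
  have hcont : Continuous fun x (v : I) ↦ latticeHat v.1 x :=
    continuous_pi fun v ↦ continuous_latticeHat v.1
  obtain ⟨p, hp, hpI, hsupp⟩ := exists_partition_of_unity hcont.continuousOn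
    (fun x _ v ↦ latticeHat_nonneg v.1 x) fun x hx ↦
      ⟨⟨_, (hI _).2 ⟨x, hx, latticeHat_floor_pos x⟩⟩, latticeHat_floor_pos x⟩
  refine ⟨I, p, hp, hpI, fun x hx v hv ↦ ?_, fun v hv ↦ (hI v).1 hv⟩
  rw [← mem_coordSupport, hsupp x hx, mem_coordSupport] at hv
  exact (latticeHat_nonneg v.1 x).lt_of_ne' hv

theorem exists_fine_partition_of_unity_sphere (d : ℕ) {δ : ℝ} (hδ : 0 < δ) :
    ∃ (I : Type) (_ : Fintype I) (p : (Fin d → ℝ) → I → ℝ), ContinuousOn p (sphere 0 1) ∧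
      MapsTo p (sphere 0 1) (stdSimplex ℝ I) ∧
      (∀ x ∈ sphere (0 : Fin d → ℝ) 1, (coordSupport (p x)).card ≤ d) ∧
      ∀ i, ∃ x ∈ sphere (0 : Fin d → ℝ) 1, ∀ y ∈ sphere 0 1, p y i ≠ 0 → dist y x < δ := by
  obtain ⟨m, hm⟩ := exists_nat_gt (2 / δ)
  have hm0 : (0 : ℝ) < m := (div_pos two_pos hδ).trans hm
  have hscale : MapsTo ((m : ℝ) • ·) (sphere (0 : Fin d → ℝ) 1) (sphere 0 m) := fun x hx ↦ by
    simp_all [norm_smul]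
  obtain ⟨I, p, hp, hpI, hhat, hcenter⟩ :=
    exists_partition_of_unity_latticeHat (isBounded_sphere (x := (0 : Fin d → ℝ)) (r := m))
  refine ⟨I, inferInstance, fun x ↦ p ((m : ℝ) • x),
    hp.comp (continuous_const_smul _).continuousOn hscale, hpI.comp hscale, fun x hx ↦ ?_,
    fun v ↦ ?_⟩
  · have hnorm : ‖(m : ℝ) • x‖ = m := mem_sphere_zero_iff_norm.1 (hscale hx)
    obtain ⟨i, hi⟩ := exists_abs_apply_eq_norm (norm_pos_iff.1 (hnorm ▸ hm0))
    obtain ⟨z, hz⟩ : ∃ z : ℤ, ((m : ℝ) • x) i = z := by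
      obtain h | h := eq_or_eq_neg_of_abs_eq (hi.trans hnorm)
      exacts [⟨m, by exact_mod_cast h⟩, ⟨-m, by exact_mod_cast h⟩]
    rw [← Finset.card_map (Function.Embedding.subtype (· ∈ I))]
    refine (card_le_of_latticeHat_pos hz fun v hv ↦ ?_).trans_eq (Fintype.card_fin d)
    obtain ⟨w, hw, rfl⟩ := Finset.mem_map.1 hv
    exact hhat _ (hscale hx) w (mem_coordSupport.1 hw)
  · obtain ⟨y, hy, hvy⟩ := hcenter v v.2
    refine ⟨(m : ℝ)⁻¹ • y, ?_, fun x hx hvx ↦ ?_⟩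
    · rw [mem_sphere_zero_iff_norm] at hy ⊢
      rw [norm_smul, hy, norm_inv, Real.norm_natCast, inv_mul_cancel₀ hm0.ne']
    · have hdist := dist_le_two_of_latticeHat_pos (hhat _ (hscale hx) v hvx) hvy
      rw [← smul_inv_smul₀ hm0.ne' y, dist_smul₀, Real.norm_natCast] at hdist
      exact lt_of_mul_lt_mul_left (hdist.trans_lt ((div_lt_iff₀ hδ).1 hm)) hm0.le

theorem exists_inv_card_add_one_lt {V : Type*} [Fintype V] {x : V → ℝ}
    (hx : x ∈ stdSimplex ℝ V) : ∃ v, ((Fintype.card V : ℝ) + 1)⁻¹ < x v := by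
  by_contra! hle
  have hsum : 1 ≤ (Fintype.card V : ℝ) * ((Fintype.card V : ℝ) + 1)⁻¹ := by
    rw [← nsmul_eq_mul]
    exact hx.2.ge.trans (Finset.sum_le_card_nsmul _ _ _ fun v _ ↦ hle v)
  rw [← div_eq_mul_inv, one_le_div (by positivity)] at hsum
  linarith

theorem exists_simplicial_approximation {V : Type*} [Fintype V] [DecidableEq V]
    {K : LowerSet (Finset V)} (hK : ∅ ∈ K) {d : ℕ} {f : (Fin d → ℝ) → V → ℝ}
    (hf : ContinuousOn f (sphere 0 1)) (hfK : MapsTo f (sphere 0 1) (polyhedron K)) :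
    ∃ (I : Type) (_ : Fintype I) (L : LowerSet (Finset I)) (g : I → V)
      (p : (Fin d → ℝ) → I → ℝ), ∅ ∈ L ∧ (∀ τ ∈ L, τ.card ≤ d) ∧ (∀ τ ∈ L, τ.image g ∈ K) ∧
      ContinuousOn p (sphere 0 1) ∧ MapsTo p (sphere 0 1) (polyhedron L) ∧
      ∀ x ∈ sphere (0 : Fin d → ℝ) 1, (coordSupport (p x)).image g ⊆ coordSupport (f x) := by
  obtain ⟨δ, hδ, hfδ⟩ := Metric.uniformContinuousOn_iff.1
    ((isCompact_sphere (0 : Fin d → ℝ) 1).uniformContinuousOn_of_continuous hf)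
    ((Fintype.card V : ℝ) + 1)⁻¹ (by positivity)
  obtain ⟨I, _, p, hp, hpI, hcard, hcenter⟩ := exists_fine_partition_of_unity_sphere d hδ
  choose q hq hpq using hcenter
  choose g hg using fun i ↦ exists_inv_card_add_one_lt (hfK (hq i)).1
  have himage : ∀ x ∈ sphere (0 : Fin d → ℝ) 1,
      (coordSupport (p x)).image g ⊆ coordSupport (f x) := fun x hx ↦ by
    refine Finset.image_subset_iff.2 fun i hi ↦ mem_coordSupport.2 fun hfi ↦ ?_
    have hdist := (dist_le_pi_dist (f x) (f (q i)) (g i)).trans_lt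
      (hfδ x hx (q i) (hq i) (hpq i x hx (mem_coordSupport.1 hi)))
    rw [Real.dist_eq, hfi, zero_sub, abs_neg] at hdist
    exact (hdist.trans (hg i)).not_ge (le_abs_self _)
  refine ⟨I, inferInstance, lowerClosure (insert ∅ ((coordSupport ∘ p) '' sphere 0 1)), g, p,
    subset_lowerClosure (mem_insert _ _), ?_, ?_, hp, fun x hx ↦ ⟨hpI hx, subset_lowerClosure <|
      mem_insert_of_mem _ (mem_image_of_mem _ hx)⟩, himage⟩
  · rintro τ ⟨-, rfl | ⟨x, hx, rfl⟩, hτ⟩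
    · simp [Finset.subset_empty.1 hτ]
    · exact (Finset.card_le_card hτ).trans (hcard x hx)
  · rintro τ ⟨-, rfl | ⟨x, hx, rfl⟩, hτ⟩
    · simpa [Finset.subset_empty.1 hτ] using hK
    · exact K.lower ((Finset.image_subset_image hτ).trans (himage x hx)) (hfK hx).2

end Approximation

section Gluing

variable {I : Type*}

/-- The cone over a complex, with apex `none`. Maps from a ball are constructed as maps from the
cone over a triangulation of its boundary. -/
def coneFaces (L : LowerSet (Finset I)) : LowerSet (Finset (Option I)) where
  carrier := {τ | τ.eraseNone ∈ L}
  lower' _ _ h hτ := L.lower (Finset.eraseNone.monotone h) hτ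

theorem mem_coneFaces {L : LowerSet (Finset I)} {τ : Finset (Option I)} :
    τ ∈ coneFaces L ↔ τ.eraseNone ∈ L := Iff.rfl

variable [Fintype I]

theorem sphereExtends_polyhedron_coneFaces {L : LowerSet (Finset I)} (hL : ∅ ∈ L) (d : ℕ) :
    SphereExtends d (polyhedron (coneFaces L)) := by
  classical
  refine sphereExtends_polyhedron_of_apex (by simpa [mem_coneFaces] using hL) none (fun τ hτ ↦ ?_) d
  have herase : (insert none τ).eraseNone = τ.eraseNone := by
    ext
    simp
  rwa [mem_coneFaces, herase]

theorem coordSupport_comp_some (x : Option I → ℝ) :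
    coordSupport (x ∘ some) = (coordSupport x).eraseNone := by
  ext i
  simp

theorem comp_some_mem_polyhedron {L : LowerSet (Finset I)} {x : Option I → ℝ}
    (hx : x ∈ polyhedron (coneFaces L)) (hx0 : x none = 0) : x ∘ some ∈ polyhedron L := by
  refine ⟨⟨fun i ↦ hx.1.1 (some i), ?_⟩, coordSupport_comp_some x ▸ hx.2⟩
  simpa [Fintype.sum_option, hx0] using hx.1.2

theorem exists_extension_coneFaces_of_carrier {E : Type*} [TopologicalSpace E]
    {C : Finset I → Set E} {L : LowerSet (Finset I)} (hC : MonotoneOn C L) (hL : ∅ ∈ L)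
    (hext : ∀ τ ∈ L, SphereExtends τ.card (C τ)) {f : (I → ℝ) → E}
    (hf : ContinuousOn f (polyhedron L)) (hfC : ∀ x ∈ polyhedron L, f x ∈ C (coordSupport x)) :
    ∃ F : (Option I → ℝ) → E, ContinuousOn F (polyhedron (coneFaces L)) ∧
      (∀ x ∈ polyhedron (coneFaces L), F x ∈ C (coordSupport x).eraseNone) ∧
      ∀ x ∈ polyhedron (coneFaces L), x none = 0 → F x = f (x ∘ some) := by
  classical
  let base : LowerSet (Finset (Option I)) := coneFaces L ⊓ LowerSet.Iic (Finset.univ.erase none)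
  have hbase : ∀ τ, τ ∈ base ↔ τ ∈ coneFaces L ∧ none ∉ τ := fun τ ↦ by
    simp [base, Finset.subset_erase]
  have hbase_mem : ∀ x, x ∈ polyhedron base ↔ x ∈ polyhedron (coneFaces L) ∧ x none = 0 :=
    fun x ↦ by
      simp only [polyhedron, mem_ofPred_eq, hbase, mem_coordSupport, not_not, and_assoc]
  have hcomp_mem : ∀ x ∈ polyhedron base, x ∘ some ∈ polyhedron L := fun x hx ↦
    let ⟨hx, hx0⟩ := (hbase_mem x).1 hx
    comp_some_mem_polyhedron hx hx0
  have hbase_ext : ∀ σ ∈ coneFaces L, σ ∉ base → ∀ d, σ.card = d + 1 →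
      SphereExtends d (C σ.eraseNone) := fun σ hσ hσb d hd ↦ by
    have hnone : none ∈ σ := by_contra fun h ↦ hσb ((hbase σ).2 ⟨hσ, h⟩)
    have hcard := Finset.card_eraseNone_of_mem hnone
    rw [hd, Nat.add_sub_cancel] at hcard
    exact hcard ▸ hext _ hσ
  obtain ⟨F, hF, hFC, hFf⟩ := exists_extension_of_carrier (C := fun τ ↦ C τ.eraseNone)
    (L := coneFaces L) (M := base) (f := fun x ↦ f (x ∘ some))
    (fun σ hσ τ hτ h ↦ hC hσ hτ (Finset.eraseNone.monotone h)) inf_le_left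
    ((hbase ∅).2 ⟨by simpa [mem_coneFaces] using hL, by simp⟩)
    hbase_ext (hf.comp (by fun_prop) fun x hx ↦ hcomp_mem x hx) fun x hx ↦
      coordSupport_comp_some x ▸ hfC _ (hcomp_mem x hx)
  exact ⟨F, hF, hFC, fun x hx hx0 ↦ hFf ((hbase_mem x).2 ⟨hx, hx0⟩)⟩

theorem exists_extension_comp_of_carrier {E : Type*} [TopologicalSpace E]
    {C : Finset I → Set E} {L : LowerSet (Finset I)} (hC : MonotoneOn C L) (hL : ∅ ∈ L)
    (hext : ∀ τ ∈ L, SphereExtends τ.card (C τ)) {f : (I → ℝ) → E}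
    (hf : ContinuousOn f (polyhedron L)) (hfC : ∀ x ∈ polyhedron L, f x ∈ C (coordSupport x))
    {d : ℕ} {p : (Fin d → ℝ) → I → ℝ} (hp : ContinuousOn p (sphere 0 1))
    (hpL : MapsTo p (sphere 0 1) (polyhedron L)) :
    ∃ F : (Fin d → ℝ) → E, ContinuousOn F (closedBall 0 1) ∧
      (∀ x ∈ closedBall 0 1, ∃ τ ∈ L, F x ∈ C τ) ∧ EqOn F (f ∘ p) (sphere 0 1) := by
  classical
  have hsome : ∀ σ ∈ L, σ.image some ∈ coneFaces L := fun σ hσ ↦ by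
    simpa [mem_coneFaces] using hσ
  obtain ⟨P, hP, hPL, hPp⟩ := sphereExtends_polyhedron_coneFaces hL d
    (FunOnFinite.linearMap ℝ ℝ some ∘ p)
    ((FunOnFinite.continuous_linearMap ℝ ℝ some).comp_continuousOn hp)
    ((mapsTo_linearMap_polyhedron hsome).comp hpL)
  obtain ⟨F, hF, hFC, hFf⟩ := exists_extension_coneFaces_of_carrier hC hL hext hf hfC
  refine ⟨F ∘ P, hF.comp hP hPL, fun x hx ↦ ⟨_, (hPL hx).2, hFC _ (hPL hx)⟩, fun x hx ↦ ?_⟩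
  have hnone : P x none = 0 := by
    rw [hPp hx]
    by_contra h
    simpa using coordSupport_linearMap_subset _ _ (mem_coordSupport.2 h)
  have hrestrict : P x ∘ some = p x := funext fun i ↦ by
    rw [Function.comp_apply, hPp hx]
    exact linearMap_apply_of_injective (Option.some_injective I) _ i
  rw [Function.comp_apply, hFf _ (hPL (sphere_subset_closedBall hx)) hnone, hrestrict,
    Function.comp_apply]

variable {V J : Type*} {A : LowerSet (Finset V)} {B : J → LowerSet (Finset V)}

theorem exists_monotoneOn_carrier {I : Type*} [DecidableEq V] [Nonempty J] (hAB : ∀ j, A ≤ B j)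
    (hB : ∀ i j, i ≠ j → B i ⊓ B j ≤ A) {d : ℕ} {L : LowerSet (Finset I)}
    (hLd : ∀ τ ∈ L, τ.card ≤ d) {g : I → V} (hg : ∀ τ ∈ L, τ.image g ∈ ⨆ j, B j) :
    ∃ D : Finset I → LowerSet (Finset V), MonotoneOn D L ∧ (∀ τ ∈ L, τ.image g ∈ D τ) ∧
      ∀ τ, (D τ = A ∧ τ.card < d) ∨ ∃ j, D τ = B j := by
  classical
  have hpiece : ∀ τ, ∃ j, τ ∈ L → τ.image g ∈ B j := fun τ ↦ by
    by_cases hτ : τ ∈ L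
    · simpa [hτ] using hg τ hτ
    · simp [hτ]
  choose c hc using hpiece
  let D : Finset I → LowerSet (Finset V) := fun τ ↦
    if τ.image g ∈ A ∧ τ.card < d then A else B (c τ)
  have hAD : ∀ τ, A ≤ D τ := fun τ ↦ by
    simp only [D]
    split_ifs
    exacts [le_rfl, hAB _]
  refine ⟨D, fun σ hσ τ hτ hστ ↦ ?_, fun τ hτ ↦ ?_, fun τ ↦ ?_⟩
  · obtain rfl | hlt := hστ.eq_or_lt
    · rfl
    have hσd : σ.card < d := (Finset.card_lt_card hlt).trans_le (hLd τ hτ)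
    by_cases hσA : σ.image g ∈ A
    · simpa only [D, if_pos (And.intro hσA hσd)] using hAD τ
    have hτA : τ.image g ∉ A := fun h ↦ hσA (A.lower (Finset.image_subset_image hστ) h)
    have hcc : c σ = c τ := by_contra fun hne ↦ hσA <| hB _ _ hne
      ⟨hc σ hσ, (B (c τ)).lower (Finset.image_subset_image hστ) (hc τ hτ)⟩
    simp only [D, hσA, hτA, false_and, if_false, hcc, le_refl]
  · by_cases h : τ.image g ∈ A ∧ τ.card < d
    · exact hAD τ h.1
    · simpa only [D, if_neg h] using hc τ hτ
  · by_cases h : τ.image g ∈ A ∧ τ.card < d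
    · exact Or.inl ⟨if_pos h, h.2⟩
    · exact Or.inr ⟨c τ, if_neg h⟩

theorem SphereExtends.iSup [Fintype V] [Nonempty J] (hA : ∅ ∈ A) (hAB : ∀ j, A ≤ B j)
    (hB : ∀ i j, i ≠ j → B i ⊓ B j ≤ A) {d : ℕ}
    (hBext : ∀ j, ∀ e ≤ d, SphereExtends e (polyhedron (B j)))
    (hAext : ∀ e < d, SphereExtends e (polyhedron A)) :
    SphereExtends d (polyhedron (⨆ j, B j)) := by
  classical
  intro f hf hfB
  have hAK : A ≤ ⨆ j, B j := (hAB (Classical.arbitrary J)).trans (le_iSup B _)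
  obtain ⟨I, _, L, g, p, hL, hLd, hg, hp, hpL, hpf⟩ :=
    exists_simplicial_approximation (hAK hA) hf hfB
  obtain ⟨D, hDmono, hgD, hD⟩ := exists_monotoneOn_carrier hAB hB hLd hg
  have hDext : ∀ τ ∈ L, SphereExtends τ.card (polyhedron (D τ)) := fun τ hτ ↦ by
    obtain ⟨hτA, hτd⟩ | ⟨j, hj⟩ := hD τ
    · exact hτA ▸ hAext _ hτd
    · exact hj ▸ hBext j _ (hLd τ hτ)
  have hDK : ∀ τ, D τ ≤ ⨆ j, B j := fun τ ↦ by
    obtain ⟨hτA, -⟩ | ⟨j, hj⟩ := hD τ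
    · exact hτA ▸ hAK
    · exact hj ▸ le_iSup B j
  obtain ⟨G, hG, hGD, hGp⟩ := exists_extension_comp_of_carrier
    (C := fun τ ↦ polyhedron (D τ)) (polyhedron_mono.comp_monotoneOn hDmono) hL hDext
    (FunOnFinite.continuous_linearMap ℝ ℝ g).continuousOn
    (fun x hx ↦ ⟨stdSimplex.image_linearMap g (mem_image_of_mem _ hx.1),
      (D _).lower (coordSupport_linearMap_subset g x) (hgD _ hx.2)⟩) hp hpL
  refine exists_extension_of_contiguous hG (fun x hx ↦ ?_) hf hfB
    fun x hx ↦ ⟨_, (hfB hx).2, ?_, Finset.Subset.rfl⟩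
  · obtain ⟨τ, -, hτ⟩ := hGD x hx
    exact polyhedron_mono (hDK τ) hτ
  · rw [hGp hx]
    exact (coordSupport_linearMap_subset g _).trans (hpf x hx)

end Gluing

section Cover

variable {κ : Type*} {n : ℕ}

/-- The complex of sets of maps `Fin n → κ` all of whose members take each value `i ∈ S` at a
common point; when `S` is everything, its nonempty faces consist of surjections and are the faces of
`K_{n,k}`. -/
def coverComplex (n : ℕ) (S : Finset κ) : LowerSet (Finset (Fin n → κ)) where
  carrier := {σ | σ.Nonempty → ∀ i ∈ S, ∃ a, ∀ φ ∈ σ, φ a = i}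
  lower' _ _ h hσ hτ i hi :=
    let ⟨a, ha⟩ := hσ (hτ.mono h) i hi
    ⟨a, fun φ hφ ↦ ha φ (h hφ)⟩

theorem mem_coverComplex {S : Finset κ} {σ : Finset (Fin n → κ)} :
    σ ∈ coverComplex n S ↔ (σ.Nonempty → ∀ i ∈ S, ∃ a, ∀ φ ∈ σ, φ a = i) := Iff.rfl

/-- The subcomplex of `coverComplex (n + 1) S` in which the point `0` is used at most for the
value `j`; these pieces, for `j ∈ S`, are glued together in the induction on `n`. -/
def coverPiece (n : ℕ) (S : Finset κ) (j : κ) : LowerSet (Finset (Fin (n + 1) → κ)) where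
  carrier := {σ | σ.Nonempty → ∀ i ∈ S, ∃ a, (a = 0 → i = j) ∧ ∀ φ ∈ σ, φ a = i}
  lower' _ _ h hσ hτ i hi :=
    let ⟨a, ha0, ha⟩ := hσ (hτ.mono h) i hi
    ⟨a, ha0, fun φ hφ ↦ ha φ (h hφ)⟩

theorem mem_coverPiece {S : Finset κ} {j : κ} {σ : Finset (Fin (n + 1) → κ)} :
    σ ∈ coverPiece n S j ↔
      (σ.Nonempty → ∀ i ∈ S, ∃ a, (a = 0 → i = j) ∧ ∀ φ ∈ σ, φ a = i) := Iff.rfl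

theorem coverComplex_succ_eq_iSup {S : Finset κ} (hS : S.Nonempty) :
    coverComplex (n + 1) S = ⨆ j : S, coverPiece n S j := by
  obtain ⟨j₀, hj₀⟩ := hS
  refine le_antisymm (fun σ hσ ↦ LowerSet.mem_iSup_iff.2 ?_) (iSup_le fun j σ hσ hne i hi ↦ ?_)
  · by_cases hzero : ∃ j ∈ S, ∀ φ ∈ σ, φ 0 = j
    · obtain ⟨j, hj, hσj⟩ := hzero
      refine ⟨⟨j, hj⟩, fun hne i hi ↦ ?_⟩
      obtain ⟨φ, hφ⟩ := hne
      obtain ⟨a, ha⟩ := hσ ⟨φ, hφ⟩ i hi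
      exact ⟨a, fun ha0 ↦ by rw [← ha φ hφ, ha0, hσj φ hφ], ha⟩
    · refine ⟨⟨j₀, hj₀⟩, fun hne i hi ↦ ?_⟩
      obtain ⟨a, ha⟩ := hσ hne i hi
      exact ⟨a, fun ha0 ↦ absurd ⟨i, hi, ha0 ▸ ha⟩ hzero, ha⟩
  · obtain ⟨a, -, ha⟩ := hσ hne i hi
    exact ⟨a, ha⟩

section

variable [DecidableEq κ] {S : Finset κ}

theorem mem_comapFaces_tail_coverComplex {σ : Finset (Fin (n + 1) → κ)} :
    σ ∈ comapFaces Fin.tail (coverComplex n S) ↔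
      (σ.Nonempty → ∀ i ∈ S, ∃ a : Fin n, ∀ φ ∈ σ, φ a.succ = i) := by
  simp [mem_comapFaces, mem_coverComplex, Fin.tail]

theorem comapFaces_tail_le_coverPiece (j : κ) :
    comapFaces Fin.tail (coverComplex n S) ≤ coverPiece n S j := fun _ hσ hne i hi ↦
  let ⟨a, ha⟩ := mem_comapFaces_tail_coverComplex.1 hσ hne i hi
  ⟨a.succ, fun h ↦ absurd h a.succ_ne_zero, ha⟩

theorem coverPiece_inf_le {i j : κ} (hij : i ≠ j) :
    coverPiece n S i ⊓ coverPiece n S j ≤ comapFaces Fin.tail (coverComplex n S) := by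
  rintro σ ⟨hσi, hσj⟩
  refine mem_comapFaces_tail_coverComplex.2 fun hne l hl ↦ ?_
  obtain ⟨a, ha0, ha⟩ : ∃ a, a ≠ 0 ∧ ∀ φ ∈ σ, φ a = l := by
    by_cases hli : l = i
    · obtain ⟨a, ha0, ha⟩ := hσj hne l hl
      exact ⟨a, fun h ↦ hij (hli.symm.trans (ha0 h)), ha⟩
    · obtain ⟨a, ha0, ha⟩ := hσi hne l hl
      exact ⟨a, fun h ↦ hli (ha0 h), ha⟩
  obtain ⟨b, rfl⟩ := Fin.exists_succ_eq.2 ha0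
  exact ⟨b, ha⟩

theorem SphereExtends.coverPiece [Fintype κ] {j : κ} {d : ℕ}
    (h : SphereExtends d (polyhedron (coverComplex n (S.erase j)))) :
    SphereExtends d (polyhedron (coverPiece n S j)) := by
  refine h.of_contiguous (r := Fin.tail) (s := Fin.cons j) (fun σ hσ ↦ ?_) (fun σ hσ ↦ ?_)
    fun σ hσ ↦ ?_
  · refine mem_comapFaces_tail_coverComplex.2 fun hne i hi ↦ ?_
    obtain ⟨hij, hiS⟩ := Finset.mem_erase.1 hi
    obtain ⟨a, ha0, ha⟩ := hσ hne i hiS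
    obtain ⟨b, rfl⟩ := Fin.exists_succ_eq.2 (mt ha0 hij)
    exact ⟨b, ha⟩
  · refine mem_coverPiece.2 fun hne i hi ↦ ?_
    simp only [Finset.forall_mem_image]
    by_cases hij : i = j
    · exact ⟨0, fun _ ↦ hij, fun _ _ ↦ hij.symm⟩
    · obtain ⟨a, ha⟩ := hσ (Finset.image_nonempty.1 hne) i (Finset.mem_erase.2 ⟨hij, hi⟩)
      exact ⟨a.succ, fun h ↦ absurd h a.succ_ne_zero, ha⟩
  · refine mem_coverPiece.2 fun hne i hi ↦ ?_
    obtain ⟨a, ha0, ha⟩ := hσ (by simpa using hne) i hi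
    refine ⟨a, ha0, Finset.forall_mem_union.2 ⟨ha, ?_⟩⟩
    simp only [Finset.forall_mem_image]
    cases a using Fin.cases with
    | zero => exact fun _ _ ↦ (ha0 rfl).symm
    | succ b => exact ha

end

theorem sphereExtends_coverComplex [Fintype κ] [Nonempty κ] {S : Finset κ} {d : ℕ}
    (h : d + S.card ≤ n) : SphereExtends d (polyhedron (coverComplex n S)) := by
  classical
  induction n generalizing d S with
  | zero =>
    obtain rfl : S = ∅ := by simpa using (Nat.le_add_left _ _).trans h
    exact sphereExtends_polyhedron_of_apex (by simp [mem_coverComplex]) Fin.elim0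
      (by simp [mem_coverComplex]) d
  | succ n ih =>
    obtain rfl | hS := S.eq_empty_or_nonempty
    · exact sphereExtends_polyhedron_of_apex (by simp [mem_coverComplex])
        (fun _ ↦ Classical.arbitrary κ) (by simp [mem_coverComplex]) d
    have := hS.coe_sort
    rw [coverComplex_succ_eq_iSup hS]
    refine SphereExtends.iSup (A := comapFaces Fin.tail (coverComplex n S))
      (by simp [mem_comapFaces, mem_coverComplex]) (fun j ↦ comapFaces_tail_le_coverPiece j.1)
      (fun i j hij ↦ coverPiece_inf_le (Subtype.coe_ne_coe.2 hij)) (fun j e he ↦ ?_)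
      fun e he ↦ ?_
    · refine (ih ?_).coverPiece
      rw [Finset.card_erase_of_mem j.2]
      have := hS.card_pos
      omega
    · exact (ih (by omega)).comapFaces fun φ _ ↦ ⟨Fin.cons (Classical.arbitrary κ) φ, rfl⟩

end Cover

section Realization

variable {V : Type*}

/-- The faces of `K` together with the empty set, which turn a complex in the sense of Mathlib into
the lower set of which `polyhedron` is the realization. -/
def facesOrEmpty (K : AbstractSimplicialComplex V) : LowerSet (Finset V) where
  carrier := {σ | σ.Nonempty → σ ∈ K.faces}
  lower' _ _ h hσ hne := (K.isRelLowerSet_faces (hσ (hne.mono h))).2 h hne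

theorem mem_facesOrEmpty {K : AbstractSimplicialComplex V} {σ : Finset V} :
    σ ∈ facesOrEmpty K ↔ (σ.Nonempty → σ ∈ K.faces) := Iff.rfl

theorem realization_eq_polyhedron [Fintype V] (K : AbstractSimplicialComplex V) :
    K.realization = polyhedron (facesOrEmpty K) := by
  refine Subset.antisymm ?_ ?_
  · rintro x ⟨hx, σ, hσ, hxσ⟩
    exact ⟨hx, (facesOrEmpty K).lower (coordSupport_subset_iff.2 hxσ) fun _ ↦ hσ⟩
  · rintro x ⟨hx, hxK⟩
    exact ⟨hx, _, hxK (coordSupport_nonempty hx), coordSupport_subset_iff.1 subset_rfl⟩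

theorem facesOrEmpty_surjComplex (n k : ℕ) :
    facesOrEmpty (surjComplex n k) =
      comapFaces Subtype.val (coverComplex n (Finset.univ : Finset (Fin k))) := by
  ext σ
  simp +contextual [mem_facesOrEmpty, mem_comapFaces, mem_coverComplex, surjComplex, Set.Nonempty]

theorem sphereExtends_surjComplex {n k d : ℕ} (hk : 1 ≤ k) (h : d + k ≤ n) :
    SphereExtends d (surjComplex n k).realization := by
  have : NeZero k := ⟨Nat.one_le_iff_ne_zero.1 hk⟩
  have hkn : k ≤ n := (Nat.le_add_left k d).trans h
  have : Nonempty (SurjVertex n k) :=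
    ⟨⟨_, Function.invFun_surjective (Fin.castLE_injective hkn)⟩⟩
  rw [realization_eq_polyhedron, facesOrEmpty_surjComplex]
  refine (sphereExtends_coverComplex (by simpa using h)).comapFaces
    fun φ hφ ↦ ⟨⟨φ, fun i ↦ ?_⟩, rfl⟩
  simpa using hφ (Finset.singleton_nonempty φ) i (Finset.mem_univ i)

theorem exists_homeomorph_euclidean_ball (d : ℕ) :
    ∃ h : EuclideanSpace ℝ (Fin d) ≃ₜ (Fin d → ℝ), h '' closedBall 0 1 = closedBall 0 1 ∧
      h '' sphere 0 1 = sphere 0 1 := by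
  let e := EuclideanSpace.equiv (Fin d) ℝ
  let B : Set (Fin d → ℝ) := e '' closedBall 0 1
  have hconvex : Convex ℝ B := (convex_closedBall 0 1).is_linear_image e.toLinearEquiv.isLinear
  have hcompact : IsCompact B := (isCompact_closedBall 0 1).image e.continuous
  have hinterior : (interior B).Nonempty :=
    ⟨e 0, (e.toHomeomorph.image_interior _).subset <|
      mem_image_of_mem e (ball_subset_interior_closedBall (mem_ball_self one_pos))⟩
  have hfrontier : frontier B = e '' sphere 0 1 := by
    rw [← frontier_closedBall _ one_ne_zero]
    exact (e.toHomeomorph.image_frontier _).symm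
  obtain ⟨h, -, hball, hsphere⟩ := exists_homeomorph_image_interior_closure_frontier_eq_unitBall
    hconvex hinterior hcompact.isBounded
  rw [hcompact.isClosed.closure_eq, image_image] at hball
  rw [hfrontier, image_image] at hsphere
  exact ⟨e.toHomeomorph.trans h, hball, hsphere⟩

theorem SphereExtends.exists_continuousMap {E : Type*} [TopologicalSpace E] [Nonempty E] {d : ℕ}
    {A : Set E} (hA : SphereExtends d A) (f : C(sphere (0 : EuclideanSpace ℝ (Fin d)) 1, A)) :
    ∃ F : C(closedBall (0 : EuclideanSpace ℝ (Fin d)) 1, A),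
      ∀ x : sphere (0 : EuclideanSpace ℝ (Fin d)) 1,
        F ⟨x.1, sphere_subset_closedBall x.2⟩ = f x := by
  obtain ⟨h, hball, hsphere⟩ := exists_homeomorph_euclidean_ball d
  let g := Function.extend Subtype.val (fun x ↦ (f x).1) fun _ ↦ Classical.arbitrary E
  have hg : ∀ x, g x.1 = (f x).1 := Subtype.val_injective.extend_apply _ _
  have hg_cont : ContinuousOn g (sphere 0 1) := by
    rw [continuousOn_iff_continuous_domRestrict]
    exact (continuous_subtype_val.comp f.continuous).congr fun x ↦ (hg x).symm
  have hsymm : MapsTo h.symm (sphere 0 1) (sphere 0 1) := by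
    rw [← hsphere]
    rintro _ ⟨x, hx, rfl⟩
    rwa [h.symm_apply_apply]
  obtain ⟨F, hF, hFA, hFg⟩ := hA.exists_extension_of_leftInvOn h.continuous.continuousOn
    (mapsTo_iff_image_subset.2 hball.subset) (mapsTo_iff_image_subset.2 hsphere.subset)
    h.symm.continuous.continuousOn
    hsymm (fun x _ ↦ h.symm_apply_apply x) hg_cont fun x hx ↦ by
      simpa only [hg ⟨x, hx⟩] using (f ⟨x, hx⟩).2
  exact ⟨⟨fun x ↦ ⟨F x.1, hFA x.2⟩, hF.domRestrict.subtype_mk _⟩,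
    fun x ↦ Subtype.ext ((hFg x.2).trans (hg x))⟩

end Realization

theorem lemma3 (n k : ℕ) (hk : 1 ≤ k) (hkn : k < n) :
    IsMConnected ((n : ℤ) - (k : ℤ) - 1) (surjComplex n k).realization := by
  intro d hd f
  exact (sphereExtends_surjComplex hk (by omega)).exists_continuousMap f
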